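/- There is a universal constant $c>0$ such that for every $\delta>0$ there is $p_0$ with the following property. Let $1\le n\le p$ be integers with $p\ge p_0$, let $0\le\epsilon<1$, and suppose that $$\frac{\sqrt{n/p}\,\log(ep/n)}{1-\epsilon}\le c .$$ Let $X\in\mathbb{R}^{n\times p}$ have i.i.d. $N(0,1)$ entries, let $Q_1,\dots,Q_p$ be arbitrary probability distributions on $\mathbb{R}$, and let $z\in\mathbb{R}^p$ be a random vector, independent of $X$, with independent coordinates $z_j\sim(1-\epsilon)\delta_0+\epsilon Q_j$. Let $\widehat\theta\in\mathbb{R}^p$ be any random vector that almost surely lies in the row space of $X$, and observe $\eta=\widehat\theta+z$. Then, with probability at least $1-\delta$, the minimization of $\|\eta-X^Tu\|_1$ over $u\in\mathbb{R}^n$ has a solution and every solution $\widetilde u$ satisfies $X^T\widetilde u=\widehat\theta$; that is, the repaired model $\widetilde\theta=X^T\widetilde u$ equals $\widehat\theta$ exactly. Moreover, the row space of $X$ contains the usual estimators: for every matrix $X\in\mathbb{R}^{n\times p}$ with rows $x_1^T,\dots,x_n^T$ and every $y\in\mathbb{R}^n$, it contains every solution of $X\theta=y$ of minimal Euclidean norm,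 and every iterate of gradient descent started at $0$, with arbitrary step sizes, for an objective $\frac1n\sum_{i=1}^n\mathcal{L}(y_i,x_i^T\theta)$ with $\mathcal{L}$ differentiable in its second argument. -/

import Mathlib

open MeasureTheory ProbabilityTheory

noncomputable section

namespace ModelRepair

/-- The row space of an `n × p` matrix: the linear span of its rows in `ℝ^p`. -/
def rowSpace {n p : ℕ} (X : Matrix (Fin n) (Fin p) ℝ) : Submodule ℝ (Fin p → ℝ) :=
  Submodule.span ℝ (Set.range X.row)

/-- The median regression objective `‖η - Xᵀ u‖₁`. -/
def l1Loss {n p : ℕ} (X : Matrix (Fin n) (Fin p) ℝ) (η : Fin p → ℝ) (u : Fin n → ℝ) : ℝ :=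
  ∑ j, |η j - (X.transpose.mulVec u) j|

/-- The set of all minimizers `argmin_u ‖η - Xᵀ u‖₁`. -/
def l1Argmin {n p : ℕ} (X : Matrix (Fin n) (Fin p) ℝ) (η : Fin p → ℝ) : Set (Fin n → ℝ) :=
  {u | ∀ v, l1Loss X η u ≤ l1Loss X η v}

/-- The set of all repaired models `Xᵀ u` with `u ∈ argmin_u ‖η - Xᵀ u‖₁`. The repaired model
is well defined and equal to `θ` exactly when this set is `{θ}`. -/
def repairedModels {n p : ℕ} (X : Matrix (Fin n) (Fin p) ℝ) (η : Fin p → ℝ) :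
    Set (Fin p → ℝ) :=
  (fun u => X.transpose.mulVec u) '' l1Argmin X η

/-- The contaminated law `(1 - ε) δ₀ + ε Q` on the real line. -/
def contaminatedLaw (ε : ℝ) (Q : Measure ℝ) : Measure ℝ :=
  ENNReal.ofReal (1 - ε) • Measure.dirac 0 + ENNReal.ofReal ε • Q

/-- `θ` is a solution of `X θ = y` of minimal Euclidean norm. -/
def IsMinNormSolution {n p : ℕ} (X : Matrix (Fin n) (Fin p) ℝ) (y : Fin n → ℝ)
    (θ : Fin p → ℝ) : Prop :=
  X.mulVec θ = y ∧ ∀ θ' : Fin p → ℝ, X.mulVec θ' = y → ∑ j, θ j ^ 2 ≤ ∑ j, θ' j ^ 2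

/-- Gradient descent, started at `0` and with step sizes `γ t`, for the objective
`θ ↦ n⁻¹ ∑ i, L (y i) (xᵢᵀ θ)`, where `xᵢ` is the `i`-th row of `X`. -/
def gradientDescent {n p : ℕ} (L : ℝ → ℝ → ℝ) (γ : ℕ → ℝ) (X : Matrix (Fin n) (Fin p) ℝ)
    (y : Fin n → ℝ) : ℕ → Fin p → ℝ
  | 0 => 0
  | t + 1 =>
    gradientDescent L γ X y t -
      γ t • (n : ℝ)⁻¹ • ∑ i, deriv (L (y i)) (X.mulVec (gradientDescent L γ X y t) i) • X.row i

end ModelRepair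

end

/-! ### Row space and the deterministic recovery condition. -/

namespace ModelRepair

open Matrix

/-! Write `θ = Xᵀ u₀`. Since |·| is convex, `u₀` is the unique minimizer as soon as, for every `v ≠
0`, the sum of `sign (z j) (Xᵀ v) j` is smaller than the ℓ¹ norm of `Xᵀ v` over the clean
coordinates (`repairedModels_eq_singleton`). This condition involves only `X` and `z`, so `θ` may
depend on both in any way.

Fix `z`, with `m` clean coordinates, and a unit vector `v`. Then `Xᵀ v` is standard Gaussian in
`ℝ^p`, so the clean norm is of order `m`. The signed sum is Gaussian with variance at most `p`:
because the signs are independent of `X`, cancellation makes it far smaller than an ℓ¹ norm, and `ε`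
may approach 1. A net of at most `385 ^ n` points makes both bounds uniform in `v`
(`signedSum_lt_cleanSum`), at the price of a signed sum of order `√(np) log(ep/n)`. Typically `m ≥
p(1-ε)/2` (`cleanCount_lower_tail`), so the hypothesis with `c = 1/1024` leaves room. The logarithm
makes the failure probability `O(1/√p)` even for bounded `n`, because `log p ≤ n log(ep/n)`. -/

theorem rowSpace_eq_range {n p : ℕ} (X : Matrix (Fin n) (Fin p) ℝ) :
    rowSpace X = LinearMap.range Xᵀ.mulVecLin := by
  rw [Matrix.range_mulVecLin]; rfl

theorem mem_rowSpace_iff {n p : ℕ} {X : Matrix (Fin n) (Fin p) ℝ} {θ : Fin p → ℝ} :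
    θ ∈ rowSpace X ↔ ∃ u, X.transpose.mulVec u = θ := by
  rw [rowSpace_eq_range]; rfl

/-- Provides a solution of `X θ = y` inside the row space whenever `y` is attainable, with no rank
assumption on `X`. -/
theorem range_mul_transpose {n p : ℕ} (X : Matrix (Fin n) (Fin p) ℝ) :
    LinearMap.range (X * Xᵀ).mulVecLin = LinearMap.range X.mulVecLin := by
  refine Submodule.eq_of_le_of_finrank_eq ?_ ?_
  · rw [Matrix.mulVecLin_mul]; exact LinearMap.range_comp_le_range _ _
  · have h := Matrix.rank_transpose_mul_self Xᵀ
    rw [Matrix.transpose_transpose, Matrix.rank_transpose] at h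
    exact h

/-- The solution `Xᵀ w` differs from `θ` by a kernel vector, which is orthogonal to the row space;
by Pythagoras, minimality forces this difference to vanish. -/
theorem IsMinNormSolution.mem_rowSpace {n p : ℕ} {X : Matrix (Fin n) (Fin p) ℝ} {y : Fin n → ℝ}
    {θ : Fin p → ℝ} (h : IsMinNormSolution X y θ) : θ ∈ rowSpace X := by
  obtain ⟨h1, h2⟩ := h
  have : y ∈ LinearMap.range (X * Xᵀ).mulVecLin := by
    rw [range_mul_transpose]; exact ⟨θ, h1⟩
  obtain ⟨w, hw⟩ := this
  simp only [Matrix.mulVecLin_apply, ← Matrix.mulVec_mulVec] at hw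
  have hle := h2 _ hw
  have horth : (θ - Xᵀ *ᵥ w) ⬝ᵥ (Xᵀ *ᵥ w) = 0 := by
    rw [Matrix.dotProduct_mulVec, Matrix.vecMul_transpose, Matrix.mulVec_sub, h1, hw]; simp
  have hk : (θ - Xᵀ *ᵥ w) ⬝ᵥ (θ - Xᵀ *ᵥ w) ≤ 0 := by
    have e : ∀ a : Fin p → ℝ, ∑ j, a j ^ 2 = a ⬝ᵥ a := fun a => by simp [dotProduct, pow_two]
    rw [e, e] at hle
    simp only [sub_dotProduct, dotProduct_sub] at horth ⊢
    rw [dotProduct_comm (Xᵀ *ᵥ w) θ] at *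
    linarith
  have hk0 : (θ - Xᵀ *ᵥ w) = 0 := by
    rw [← dotProduct_self_eq_zero]
    exact le_antisymm hk (Finset.sum_nonneg fun i _ => mul_self_nonneg _)
  exact mem_rowSpace_iff.2 ⟨w, (sub_eq_zero.1 hk0).symm⟩

theorem gradientDescent_mem_rowSpace {n p : ℕ} (L : ℝ → ℝ → ℝ) (γ : ℕ → ℝ)
    (X : Matrix (Fin n) (Fin p) ℝ) (y : Fin n → ℝ) (t : ℕ) :
    gradientDescent L γ X y t ∈ rowSpace X := by
  induction t with
  | zero => exact Submodule.zero_mem _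
  | succ t ih =>
    refine Submodule.sub_mem _ ih (Submodule.smul_mem _ _ (Submodule.smul_mem _ _
      (Submodule.sum_mem _ fun i _ => Submodule.smul_mem _ _ (Submodule.subset_span ⟨i, rfl⟩))))

/-- Subgradient inequality for |·| at `a`, whose sign is written `a / |a|`. -/
theorem abs_sub_ge_of_ne_zero {a : ℝ} (ha : a ≠ 0) (w : ℝ) : |a| - a / |a| * w ≤ |a - w| := by
  rcases lt_or_gt_of_ne ha with h | h
  · rw [abs_of_neg h, div_neg, div_self ha]
    linarith [neg_abs_le (a - w)]
  · rw [abs_of_pos h, div_self ha]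
    linarith [le_abs_self (a - w)]

/-- Null-space type condition for exact recovery: the signed sum over the contaminated coordinates
is dominated by the `ℓ¹` norm over the clean coordinates. -/
theorem repairedModels_eq_singleton {n p : ℕ} {X : Matrix (Fin n) (Fin p) ℝ} {θ z : Fin p → ℝ}
    (hθ : θ ∈ rowSpace X)
    (h : ∀ v : Fin n → ℝ, v ≠ 0 → ∑ j, z j / |z j| * (Xᵀ *ᵥ v) j <
      ∑ j, if z j = 0 then |(Xᵀ *ᵥ v) j| else 0) :
    repairedModels X (θ + z) = {θ} := by
  obtain ⟨u₀, rfl⟩ := mem_rowSpace_iff.1 hθ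
  have key : ∀ u, u ≠ u₀ → l1Loss X (Xᵀ *ᵥ u₀ + z) u₀ < l1Loss X (Xᵀ *ᵥ u₀ + z) u := by
    intro u hu
    have h1 := h (u - u₀) (sub_ne_zero.2 hu)
    -- Where `z j = 0`, the convention `0 / 0 = 0` removes the sign term.
    have h2 : ∀ j, |z j| - z j / |z j| * (Xᵀ *ᵥ (u - u₀)) j +
        (if z j = 0 then |(Xᵀ *ᵥ (u - u₀)) j| else 0) ≤ |(Xᵀ *ᵥ u₀ + z) j - (Xᵀ *ᵥ u) j| := by
      intro j
      have e : (Xᵀ *ᵥ u₀ + z) j - (Xᵀ *ᵥ u) j = z j - (Xᵀ *ᵥ (u - u₀)) j := by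
        rw [Matrix.mulVec_sub]; simp; ring
      rw [e]
      split_ifs with hz
      · simp [hz]
      · simpa using abs_sub_ge_of_ne_zero hz _
    have h3 := Finset.sum_le_sum fun j (_ : j ∈ Finset.univ) => h2 j
    rw [Finset.sum_add_distrib, Finset.sum_sub_distrib] at h3
    have h4 : l1Loss X (Xᵀ *ᵥ u₀ + z) u₀ = ∑ j, |z j| := by simp [l1Loss]
    rw [h4]
    unfold l1Loss
    linarith
  have : l1Argmin X (Xᵀ *ᵥ u₀ + z) = {u₀} := by
    ext u
    refine ⟨fun hu => ?_, ?_⟩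
    · by_contra hne
      exact absurd (hu u₀) (not_le.2 (key u hne))
    · rintro rfl v
      by_cases hv : v = u
      · rw [hv]
      · exact (key v hv).le
  rw [repairedModels, this, Set.image_singleton]

end ModelRepair

/-! ### Nets of the sphere and operator norms. -/

namespace ModelRepair

open Metric Module
open scoped ENNReal NNReal

/-- Volume bound on the number of `η`-separated points of the unit ball. -/
theorem card_le_of_separated {E : Type*} [NormedAddCommGroup E] [NormedSpace ℝ E]
    [FiniteDimensional ℝ E] {η : ℝ} (hη : 0 < η) (s : Finset E) (hs : ∀ c ∈ s, ‖c‖ ≤ 1)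
    (h : ∀ c ∈ s, ∀ d ∈ s, c ≠ d → η ≤ ‖c - d‖) :
    (s.card : ℝ) ≤ (1 + 2 / η) ^ finrank ℝ E := by
  borelize E
  let μ : Measure E := Measure.addHaar
  have δpos : 0 < η / 2 := by positivity
  have ρpos : 0 < 1 + η / 2 := by positivity
  have D : (s : Set E).PairwiseDisjoint fun c => ball c (η / 2) := by
    intro c hc d hd hcd
    apply ball_disjoint_ball
    rw [dist_eq_norm, add_halves]
    exact h c hc d hd hcd
  have hsub : (⋃ c ∈ s, ball c (η / 2)) ⊆ ball (0 : E) (1 + η / 2) := by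
    refine Set.iUnion₂_subset fun x hx => ball_subset_ball' ?_
    rw [dist_zero_right]; linarith [hs x hx]
  have I := measure_mono (μ := μ) hsub
  rw [measure_biUnion_finset D fun c _ => measurableSet_ball] at I
  simp only [μ.addHaar_ball_of_pos _ δpos, μ.addHaar_ball_of_pos _ ρpos, Finset.sum_const,
    nsmul_eq_mul, ← mul_assoc] at I
  have J := (ENNReal.mul_le_mul_iff_left (measure_ball_pos _ _ zero_lt_one).ne'
    measure_ball_lt_top.ne).1 I
  have K := ENNReal.toReal_le_of_le_ofReal (by positivity) J
  rw [ENNReal.toReal_mul, ENNReal.toReal_natCast, ENNReal.toReal_ofReal (by positivity)] at K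
  have e : 1 + 2 / η = (1 + η / 2) / (η / 2) := by field_simp; ring
  rw [e, div_pow, le_div_iff₀ (by positivity)]
  exact K

/-- The unit sphere has an `η`-net of at most `(1 + 2 / η) ^ dim` points. -/
theorem exists_sphere_net (E : Type*) [NormedAddCommGroup E] [NormedSpace ℝ E]
    [FiniteDimensional ℝ E] {η : ℝ} (hη : 0 < η) :
    ∃ N : Finset E, (∀ c ∈ N, ‖c‖ = 1) ∧ (N.card : ℝ) ≤ (1 + 2 / η) ^ finrank ℝ E ∧
      ∀ v : E, ‖v‖ = 1 → ∃ c ∈ N, ‖v - c‖ ≤ η := by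
  have hcard : ∀ s : Finset E, (s : Set E) ⊆ sphere 0 1 → IsSeparated (η.toNNReal : ℝ≥0∞) (s : Set E) →
      (s.card : ℝ) ≤ (1 + 2 / η) ^ finrank ℝ E := by
    intro s hs hsep
    refine card_le_of_separated hη s (fun c hc => ?_) fun c hc d hd hcd => ?_
    · simpa using (mem_sphere_zero_iff_norm.1 (hs hc)).le
    · have : (η.toNNReal : ℝ≥0∞) < edist c d := hsep hc hd hcd
      rw [edist_dist, ← ENNReal.ofReal, ENNReal.ofReal_lt_ofReal_iff_of_nonneg hη.le,
        dist_eq_norm] at this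
      exact this.le
  -- A separated set might be infinite, while the volume bound concerns finite sets; so a subset
  -- with one point too many is extracted.
  have hpack : packingNumber η.toNNReal (sphere (0 : E) 1) ≠ ⊤ := by
    refine ne_top_of_le_ne_top (ENat.natCast_ne_top ⌊(1 + 2 / η) ^ finrank ℝ E⌋₊) ?_
    refine iSup_le fun C => iSup_le fun hC => iSup_le fun hsep => ?_
    by_contra! hlt
    obtain ⟨t, htC, ht⟩ := Set.exists_subset_encard_eq (Order.add_one_le_of_lt hlt)
    have hfin : t.Finite := Set.finite_of_encard_eq_coe (k := ⌊(1 + 2 / η) ^ finrank ℝ E⌋₊ + 1) (by simpa using ht)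
    have h1 := hcard hfin.toFinset (by simpa using htC.trans hC) (by simpa using hsep.subset htC)
    rw [hfin.encard_eq_coe_toFinset_card] at ht
    have h2 : hfin.toFinset.card = ⌊(1 + 2 / η) ^ finrank ℝ E⌋₊ + 1 := by exact_mod_cast ht
    have h3 := Nat.le_floor h1
    omega
  have hfin : (maximalSeparatedSet η.toNNReal (sphere (0 : E) 1)).Finite := by
    rw [← Set.encard_ne_top_iff, encard_maximalSeparatedSet hpack]; exact hpack
  refine ⟨hfin.toFinset, fun c hc => ?_, hcard _ ?_ ?_, fun v hv => ?_⟩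
  · exact mem_sphere_zero_iff_norm.1 (maximalSeparatedSet_subset (by simpa using hc))
  · simpa using maximalSeparatedSet_subset
  · simpa using isSeparated_maximalSeparatedSet
  · obtain ⟨c, hc, hvc⟩ := isCover_maximalSeparatedSet hpack (mem_sphere_zero_iff_norm.2 hv)
    refine ⟨c, by simpa using hc, ?_⟩
    have hvc : edist v c ≤ (η.toNNReal : ℝ≥0∞) := hvc
    rw [edist_dist, ← ENNReal.ofReal, ENNReal.ofReal_le_ofReal_iff hη.le, dist_eq_norm] at hvc
    exact hvc

section Net

variable {E F : Type*} [NormedAddCommGroup E] [NormedSpace ℝ E] [NormedAddCommGroup F]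
  [NormedSpace ℝ F] {η : ℝ} {N : Finset E}

/-- Approximation by the net costs at most `‖T‖ / 2`, which is absorbed on the left. -/
theorem opNorm_le_of_net (hη : η ≤ 1 / 2) (hN : ∀ v : E, ‖v‖ = 1 → ∃ c ∈ N, ‖v - c‖ ≤ η)
    (T : E →L[ℝ] F) {C : ℝ} (hC : 0 ≤ C) (hT : ∀ c ∈ N, ‖T c‖ ≤ C) : ‖T‖ ≤ 2 * C := by
  have h : ‖T‖ ≤ C + 1 / 2 * ‖T‖ := by
    refine T.opNorm_le_of_unit_norm (by positivity) fun v hv => ?_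
    obtain ⟨c, hc, hvc⟩ := hN v hv
    calc ‖T v‖ = ‖T c + T (v - c)‖ := by rw [← map_add]; simp
      _ ≤ ‖T c‖ + ‖T (v - c)‖ := norm_add_le _ _
      _ ≤ C + ‖T‖ * (1 / 2) :=
        add_le_add (hT c hc) (T.le_opNorm_of_le (hvc.trans hη))
      _ = _ := by ring
  linarith

theorem le_norm_apply_of_net (hN : ∀ v : E, ‖v‖ = 1 → ∃ c ∈ N, ‖v - c‖ ≤ η)
    (T : E →L[ℝ] F) {B : ℝ} (hT : ∀ c ∈ N, B ≤ ‖T c‖) {v : E} (hv : ‖v‖ = 1) :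
    B - ‖T‖ * η ≤ ‖T v‖ := by
  obtain ⟨c, hc, hvc⟩ := hN v hv
  have h1 : ‖T c‖ ≤ ‖T v‖ + ‖T (v - c)‖ := by
    have := norm_sub_le (T v) (T (v - c))
    rwa [← map_sub, sub_sub_cancel] at this
  linarith [hT c hc, T.le_opNorm_of_le hvc]

end Net

end ModelRepair

/-! ### Chernoff bounds and Gaussian integrals. -/

namespace ModelRepair

open scoped ENNReal NNReal

/-- Chernoff bound for a sum of functions of independent coordinates. -/
theorem pi_chernoff {ι : Type*} [Fintype ι] {P : ι → Measure ℝ} [∀ j, IsProbabilityMeasure (P j)]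
    {f : ι → ℝ → ℝ} (hf : ∀ j, Measurable (f j)) {B : ι → ℝ} (hB : ∀ j, 0 ≤ B j)
    (h : ∀ j, ∫⁻ x, ENNReal.ofReal (Real.exp (f j x)) ∂P j ≤ ENNReal.ofReal (B j)) (a : ℝ) :
    Measure.pi P {x | a ≤ ∑ j, f j (x j)} ≤ ENNReal.ofReal (Real.exp (-a) * ∏ j, B j) := by
  have hind : iIndepFun (fun j (x : ι → ℝ) => ENNReal.ofReal (Real.exp (f j (x j))))
      (Measure.pi P) :=
    iIndepFun_pi (X := fun j x => ENNReal.ofReal (Real.exp (f j x)))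
      fun j => (by fun_prop : Measurable _).aemeasurable
  have hint : ∫⁻ x, ENNReal.ofReal (Real.exp (∑ j, f j (x j))) ∂Measure.pi P ≤
      ENNReal.ofReal (∏ j, B j) := by
    simp_rw [Real.exp_sum, ENNReal.ofReal_prod_of_nonneg fun _ _ => (Real.exp_pos _).le]
    rw [lintegral_prod_eq_prod_lintegral_of_indepFun _ _ hind fun j => by fun_prop,
      ENNReal.ofReal_prod_of_nonneg fun j _ => hB j]
    refine Finset.prod_le_prod' fun j _ => le_trans (le_of_eq ?_) (h j)
    exact (measurePreserving_eval P j).lintegral_comp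
      (f := fun y => ENNReal.ofReal (Real.exp (f j y))) (by fun_prop)
  calc Measure.pi P {x | a ≤ ∑ j, f j (x j)}
      = Measure.pi P {x | ENNReal.ofReal (Real.exp a) ≤
          ENNReal.ofReal (Real.exp (∑ j, f j (x j)))} := by
        congr 1; ext x
        simp [ENNReal.ofReal_le_ofReal_iff (Real.exp_pos _).le]
    _ ≤ (∫⁻ x, ENNReal.ofReal (Real.exp (∑ j, f j (x j))) ∂Measure.pi P) /
          ENNReal.ofReal (Real.exp a) :=
        meas_ge_le_lintegral_div (Measurable.aemeasurable (by fun_prop)) (by simp [Real.exp_pos]) ENNReal.ofReal_ne_top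
    _ ≤ ENNReal.ofReal (∏ j, B j) / ENNReal.ofReal (Real.exp a) := by gcongr
    _ = _ := by
        rw [← ENNReal.ofReal_div_of_pos (Real.exp_pos _), Real.exp_neg]
        congr 1; field_simp

theorem lintegral_exp_mul_gaussianReal (t : ℝ) :
    ∫⁻ x, ENNReal.ofReal (Real.exp (t * x)) ∂gaussianReal 0 1 =
      ENNReal.ofReal (Real.exp (t ^ 2 / 2)) := by
  rw [← ofReal_integral_eq_lintegral_ofReal (integrable_exp_mul_gaussianReal t)
    (ae_of_all _ fun _ => (Real.exp_pos _).le)]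
  have := congrFun (mgf_fun_id_gaussianReal (μ := 0) (v := 1)) t
  simp only [mgf] at this
  rw [this]; simp

theorem lintegral_exp_abs_gaussianReal_le :
    ∫⁻ x, ENNReal.ofReal (Real.exp |x|) ∂gaussianReal 0 1 ≤
      ENNReal.ofReal (2 * Real.exp (1 / 2)) := by
  calc ∫⁻ x, ENNReal.ofReal (Real.exp |x|) ∂gaussianReal 0 1
      ≤ ∫⁻ x, (ENNReal.ofReal (Real.exp (1 * x)) + ENNReal.ofReal (Real.exp (-1 * x)))
          ∂gaussianReal 0 1 := by
        refine lintegral_mono fun x => ?_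
        rw [← ENNReal.ofReal_add (Real.exp_pos _).le (Real.exp_pos _).le]
        refine ENNReal.ofReal_le_ofReal ?_
        rcases abs_cases x with ⟨h, _⟩ | ⟨h, _⟩ <;> rw [h] <;> simp [Real.exp_nonneg]
    _ = _ := by
        rw [lintegral_add_left (by fun_prop), lintegral_exp_mul_gaussianReal,
          lintegral_exp_mul_gaussianReal, ← ENNReal.ofReal_add (Real.exp_pos _).le (Real.exp_pos _).le]
        norm_num [two_mul]

/-- The density is at most `1/2`, since `√(2π) ≥ 2`. The decay in `t` expresses that a Gaussian is
rarely near 0. -/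
theorem lintegral_exp_neg_abs_gaussianReal_le {t : ℝ} (ht : 0 < t) :
    ∫⁻ x, ENNReal.ofReal (Real.exp (-t * |x|)) ∂gaussianReal 0 1 ≤ ENNReal.ofReal (1 / t) := by
  have hint : ∫ x : ℝ, Real.exp (-t * |x|) = 2 / t := by
    rw [integral_comp_abs (f := fun x => Real.exp (-t * x)), integral_exp_mul_Ioi (by linarith)]
    simp; field_simp
  -- A non-integrable function would have integral 0 by convention.
  have hI : Integrable fun x : ℝ => Real.exp (-t * |x|) := by
    by_contra hne
    rw [integral_undef hne] at hint
    have : 0 < 2 / t := by positivity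
    linarith
  have hpdf : ∀ x : ℝ, gaussianPDF 0 1 x ≤ ENNReal.ofReal (1 / 2) := by
    intro x
    refine ENNReal.ofReal_le_ofReal ?_
    rw [gaussianPDFReal]
    have h1 : (2 : ℝ) ≤ √(2 * Real.pi * (1 : ℝ≥0)) := by
      refine Real.le_sqrt_of_sq_le ?_
      have := Real.two_le_pi
      simp; linarith
    have h2 : Real.exp (-(x - 0) ^ 2 / (2 * (1 : ℝ≥0))) ≤ 1 := by
      refine Real.exp_le_one_iff.2 ?_
      exact div_nonpos_of_nonpos_of_nonneg (neg_nonpos.2 (sq_nonneg _)) (by simp)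
    have h3 : (√(2 * Real.pi * (1 : ℝ≥0)))⁻¹ ≤ 1 / 2 := by
      rw [one_div]; exact inv_anti₀ (by norm_num) h1
    calc _ ≤ 1 / 2 * (1 : ℝ) := by gcongr
      _ = 1 / 2 := by ring
  rw [gaussianReal_of_var_ne_zero _ one_ne_zero,
    lintegral_withDensity_eq_lintegral_mul _ (measurable_gaussianPDF _ _) (by fun_prop)]
  calc _ ≤ ∫⁻ x : ℝ, ENNReal.ofReal (1 / 2) * ENNReal.ofReal (Real.exp (-t * |x|)) :=
        lintegral_mono fun x => mul_le_mul_left (hpdf x) _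
    _ = _ := by
        rw [lintegral_const_mul _ (by fun_prop), ← ofReal_integral_eq_lintegral_ofReal hI
          (ae_of_all _ fun _ => (Real.exp_pos _).le), hint, ← ENNReal.ofReal_mul (by norm_num)]
        congr 1; ring

/-- If `X` has independent standard Gaussian entries and `v` is a unit vector, then `Xᵀ v` has
independent standard Gaussian coordinates. -/
theorem map_gaussian_transpose_mulVec {n p : ℕ} (v : Fin n → ℝ) (hv : ∑ i, v i ^ 2 = 1) :
    (Measure.pi fun _ : Fin n × Fin p => gaussianReal 0 1).map
      (fun x j => ∑ i, x (i, j) * v i) = Measure.pi fun _ : Fin p => gaussianReal 0 1 := by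
  have hm : Measurable fun (x : Fin n × Fin p → ℝ) (j : Fin p) => ∑ i, x (i, j) * v i := by
    fun_prop
  have := Measure.isProbabilityMeasure_map (μ := Measure.pi fun _ : Fin n × Fin p => gaussianReal 0 1)
    hm.aemeasurable
  refine charFun_eq_pi_iff.1 fun t => ?_
  -- Pairing `Xᵀ v` with `t` is pairing `X` with the tensor `v ⊗ t`.
  let s : EuclideanSpace ℝ (Fin n × Fin p) := WithLp.toLp 2 fun ij => v ij.1 * t ij.2
  have h1 : charFun (((Measure.pi fun _ : Fin n × Fin p => gaussianReal 0 1).map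
      (fun x j => ∑ i, x (i, j) * v i)).map (WithLp.toLp 2)) t =
      charFun ((Measure.pi fun _ : Fin n × Fin p => gaussianReal 0 1).map (WithLp.toLp 2)) s := by
    rw [Measure.map_map (by fun_prop) hm, charFun_apply, charFun_apply,
      integral_map ((WithLp.measurable_toLp 2 _).comp hm).aemeasurable
        (Measurable.aestronglyMeasurable (by fun_prop)),
      integral_map (by fun_prop) (Measurable.aestronglyMeasurable (by fun_prop))]
    congr 1; ext x; congr 3
    simp only [PiLp.inner_apply, Fintype.sum_prod_type_right, s, Function.comp]
    refine Finset.sum_congr rfl fun j _ => ?_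
    simp [Finset.mul_sum]
    refine Finset.sum_congr rfl fun j _ => by ring
  rw [h1, charFun_pi, Fintype.prod_prod_type_right]
  refine Finset.prod_congr rfl fun j _ => ?_
  simp only [charFun_gaussianReal, ← Complex.exp_sum, s]
  congr 1
  have hv' : ∑ i, (v i : ℂ) ^ 2 = 1 := by exact_mod_cast congrArg (fun r : ℝ => (r : ℂ)) hv
  simp [mul_pow, ← Finset.sum_div, ← Finset.sum_mul, hv']

end ModelRepair

/-! ### Deviation bounds and their uniform version. -/

namespace ModelRepair

open scoped ENNReal NNReal

/-- The number of uncontaminated coordinates. -/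
noncomputable def cleanCount {p : ℕ} (z : Fin p → ℝ) : ℕ := (Finset.univ.filter fun j => z j = 0).card

/-- The `ℓ¹` norm of `Xᵀ v` over the uncontaminated coordinates. -/
noncomputable def cleanSum {n p : ℕ} (x : Fin n × Fin p → ℝ) (z : Fin p → ℝ) (v : Fin n → ℝ) : ℝ :=
  ∑ j, if z j = 0 then |∑ i, x (i, j) * v i| else 0

/-- The sum of the coordinates of `Xᵀ v`, weighted by the signs of the contamination. -/
noncomputable def signedSum {n p : ℕ} (x : Fin n × Fin p → ℝ) (z : Fin p → ℝ) (v : Fin n → ℝ) : ℝ :=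
  ∑ j, z j / |z j| * ∑ i, x (i, j) * v i

theorem prod_ite_eq_pow_cleanCount {p : ℕ} (z : Fin p → ℝ) (b : ℝ) :
    ∏ j, (if z j = 0 then b else 1) = b ^ cleanCount z := by
  rw [Finset.prod_ite, Finset.prod_const, Finset.prod_const_one, mul_one, cleanCount]

section Tails

variable {n p : ℕ} {v : Fin n → ℝ} (hv : ∑ i, v i ^ 2 = 1) (z : Fin p → ℝ)

include hv

theorem gaussian_transpose_mulVec_le (S : Set (Fin p → ℝ)) :
    (Measure.pi fun _ : Fin n × Fin p => gaussianReal 0 1) {x | (fun j => ∑ i, x (i, j) * v i) ∈ S} ≤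
      (Measure.pi fun _ : Fin p => gaussianReal 0 1) S := by
  rw [← map_gaussian_transpose_mulVec v hv]
  exact Measure.le_map_apply (Measurable.aemeasurable (by fun_prop)) S

/-- Chernoff with parameter `-16`: each clean coordinate contributes a factor `e / 16 ≤ e^(-3/2)`.
-/
theorem cleanSum_lower_tail :
    (Measure.pi fun _ : Fin n × Fin p => gaussianReal 0 1)
      {x | cleanSum x z v ≤ cleanCount z / 16} ≤
      ENNReal.ofReal (Real.exp (-(3 / 2) * cleanCount z)) := by
  refine (measure_mono fun x hx => ?_).trans ((gaussian_transpose_mulVec_le hv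
    {y | -(cleanCount z : ℝ) ≤ ∑ j, if z j = 0 then -16 * |y j| else 0}).trans
    ((pi_chernoff (f := fun j y => if z j = 0 then -16 * |y| else 0)
      (B := fun j => if z j = 0 then 1 / 16 else 1) (fun j => ?_) (fun j => ?_) (fun j => ?_)
      _).trans (ENNReal.ofReal_le_ofReal ?_)))
  · have e : ∑ j, (if z j = 0 then -16 * |∑ i, x (i, j) * v i| else 0) = -16 * cleanSum x z v := by
      simp [cleanSum, Finset.mul_sum]
    have hx : cleanSum x z v ≤ cleanCount z / 16 := hx
    simp only [Set.mem_ofPred_eq, e]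
    linarith
  · split_ifs <;> fun_prop
  · split_ifs <;> norm_num
  · split_ifs
    · exact lintegral_exp_neg_abs_gaussianReal_le (by norm_num)
    · simp
  · rw [prod_ite_eq_pow_cleanCount, neg_neg, mul_comm (-(3 / 2) : ℝ), Real.exp_nat_mul,
      ← Real.exp_one_pow, ← mul_pow]
    refine pow_le_pow_left₀ (by positivity) ?_ _
    have h1 : Real.exp (5 / 2) ≤ 16 := by
      have : Real.exp (5 / 2) ≤ Real.exp 1 ^ 3 / Real.exp (1 / 2) := by
        rw [← Real.exp_nat_mul, ← Real.exp_sub]; norm_num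
      have h3 : (3 / 2 : ℝ) ≤ Real.exp (1 / 2) := by
        have := Real.add_one_le_exp (1 / 2 : ℝ); linarith
      have h4 : Real.exp 1 ^ 3 ≤ 2.72 ^ 3 :=
        pow_le_pow_left₀ (Real.exp_pos _).le (Real.exp_one_lt_d9.le.trans (by norm_num)) _
      refine this.trans ((div_le_iff₀ (by positivity)).2 ?_)
      nlinarith
    have h2 : Real.exp 1 = Real.exp (5 / 2) * Real.exp (-(3 / 2)) := by
      rw [← Real.exp_add]; norm_num
    rw [h2]
    nlinarith [Real.exp_pos (-(3 / 2) : ℝ)]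

theorem cleanSum_upper_tail :
    (Measure.pi fun _ : Fin n × Fin p => gaussianReal 0 1)
      {x | 3 * cleanCount z ≤ cleanSum x z v} ≤
      ENNReal.ofReal (Real.exp (-(3 / 2) * cleanCount z)) := by
  refine (gaussian_transpose_mulVec_le hv
    {y | 3 * (cleanCount z : ℝ) ≤ ∑ j, if z j = 0 then |y j| else 0}).trans
    ((pi_chernoff (f := fun j y => if z j = 0 then |y| else 0)
      (B := fun j => if z j = 0 then 2 * Real.exp (1 / 2) else 1) (fun j => ?_) (fun j => ?_)
      (fun j => ?_) _).trans (ENNReal.ofReal_le_ofReal ?_))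
  · split_ifs <;> fun_prop
  · split_ifs <;> positivity
  · split_ifs
    · exact lintegral_exp_abs_gaussianReal_le
    · simp
  · rw [prod_ite_eq_pow_cleanCount, mul_comm (-(3 / 2) : ℝ), Real.exp_nat_mul,
      show -(3 * (cleanCount z : ℝ)) = cleanCount z * (-3) by ring, Real.exp_nat_mul, ← mul_pow]
    refine pow_le_pow_left₀ (by positivity) ?_ _
    have h1 : (2 : ℝ) ≤ Real.exp 1 := by linarith [Real.add_one_le_exp (1 : ℝ)]
    calc Real.exp (-3) * (2 * Real.exp (1 / 2))
        ≤ Real.exp (-3) * (Real.exp 1 * Real.exp (1 / 2)) := by gcongr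
      _ = Real.exp (-(3 / 2)) := by rw [← Real.exp_add, ← Real.exp_add]; norm_num

/-- The weights are at most 1 in absolute value, so the variance is at most `p`; `a / p` is the
optimal Chernoff parameter for variance `p`. -/
theorem signedSum_tail (hp : 0 < p) {a : ℝ} (ha : 0 ≤ a) {σ : ℝ} (hσ : |σ| = 1) :
    (Measure.pi fun _ : Fin n × Fin p => gaussianReal 0 1) {x | a ≤ σ * signedSum x z v} ≤
      ENNReal.ofReal (Real.exp (-(a ^ 2 / (2 * p)))) := by
  have hp' : (0 : ℝ) < p := by exact_mod_cast hp
  refine (measure_mono fun x hx => ?_).trans ((gaussian_transpose_mulVec_le hv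
    {y | a ^ 2 / p ≤ ∑ j, a / p * (σ * (z j / |z j|)) * y j}).trans
    ((pi_chernoff (f := fun j y => a / p * (σ * (z j / |z j|)) * y)
      (B := fun j => Real.exp ((a / p) ^ 2 / 2)) (fun j => by fun_prop)
      (fun j => (Real.exp_pos _).le) (fun j => ?_) _).trans (ENNReal.ofReal_le_ofReal ?_)))
  · have hx : a ≤ σ * signedSum x z v := hx
    have e : ∑ j, a / p * (σ * (z j / |z j|)) * ∑ i, x (i, j) * v i =
        a / p * (σ * signedSum x z v) := by
      simp only [signedSum, Finset.mul_sum]; congr! 2; ring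
    simp only [Set.mem_ofPred_eq, e]
    calc a ^ 2 / p = a / p * a := by ring
      _ ≤ _ := by gcongr
  · rw [lintegral_exp_mul_gaussianReal]
    refine ENNReal.ofReal_le_ofReal (Real.exp_le_exp.2 ?_)
    have h1 : (σ * (z j / |z j|)) ^ 2 ≤ 1 := by
      rw [sq_le_one_iff_abs_le_one, abs_mul, hσ, one_mul, abs_div, abs_abs]
      exact div_self_le_one _
    rw [mul_pow]
    nlinarith [sq_nonneg (a / p)]
  · rw [Finset.prod_const, ← Real.exp_nat_mul, ← Real.exp_add]
    refine Real.exp_le_exp.2 (le_of_eq ?_)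
    simp only [Finset.card_univ, Fintype.card_fin]
    field_simp; ring

end Tails

/-- The event that one of the four deviation bounds fails on the finite set `N`. -/
def deviation {n p : ℕ} (N : Finset (EuclideanSpace ℝ (Fin n))) (a : ℝ) (z : Fin p → ℝ) :
    Set (Fin n × Fin p → ℝ) :=
  ⋃ v ∈ N, ({x | cleanSum x z v ≤ cleanCount z / 16} ∪ {x | 3 * cleanCount z ≤ cleanSum x z v}) ∪
    ({x | a ≤ 1 * signedSum x z v} ∪ {x | a ≤ -1 * signedSum x z v})

theorem measure_deviation_le {n p : ℕ} {N : Finset (EuclideanSpace ℝ (Fin n))}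
    (hN : ∀ v ∈ N, ‖v‖ = 1) (hp : 0 < p) {a : ℝ} (ha : 0 ≤ a) (z : Fin p → ℝ) :
    (Measure.pi fun _ : Fin n × Fin p => gaussianReal 0 1) (deviation N a z) ≤
      ENNReal.ofReal (N.card * (2 * Real.exp (-(3 / 2) * cleanCount z) +
        2 * Real.exp (-(a ^ 2 / (2 * p))))) := by
  refine (measure_biUnion_finset_le _ _).trans ?_
  rw [ENNReal.ofReal_mul (by positivity), ENNReal.ofReal_natCast, ← nsmul_eq_mul]
  refine Finset.sum_le_card_nsmul _ _ _ fun v hv => ?_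
  have hv1 : ∑ i, v i ^ 2 = 1 := by
    rw [← EuclideanSpace.real_norm_sq_eq, hN v hv, one_pow]
  rw [two_mul, two_mul, ENNReal.ofReal_add (by positivity) (by positivity),
    ENNReal.ofReal_add (by positivity) (by positivity),
    ENNReal.ofReal_add (by positivity) (by positivity)]
  refine (measure_union_le _ _).trans (add_le_add ((measure_union_le _ _).trans (add_le_add ?_ ?_))
    ((measure_union_le _ _).trans (add_le_add ?_ ?_)))
  · exact cleanSum_lower_tail hv1 z
  · exact cleanSum_upper_tail hv1 z
  · exact signedSum_tail hv1 z hp ha (by simp)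
  · exact signedSum_tail hv1 z hp ha (by simp)

theorem measurable_cleanCount {p : ℕ} :
    Measurable fun z : Fin p → ℝ => (cleanCount z : ℝ) := by
  simp only [cleanCount, Finset.card_filter, Nat.cast_sum, Nat.cast_ite]
  exact Finset.measurable_fun_sum _ fun j _ => Measurable.ite
    (measurableSet_eq_fun (by fun_prop) (by fun_prop)) measurable_const measurable_const

/-- Joint measurability allows conditioning on `z` by Fubini. -/
theorem measurableSet_deviation {n p : ℕ} (N : Finset (EuclideanSpace ℝ (Fin n))) (a : ℝ) :
    MeasurableSet {q : (Fin n × Fin p → ℝ) × (Fin p → ℝ) | q.1 ∈ deviation N a q.2} := by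
  have hz : ∀ j : Fin p, MeasurableSet {q : (Fin n × Fin p → ℝ) × (Fin p → ℝ) | q.2 j = 0} :=
    fun j => measurableSet_eq_fun (by fun_prop) (by fun_prop)
  have hc : Measurable fun q : (Fin n × Fin p → ℝ) × (Fin p → ℝ) => (cleanCount q.2 : ℝ) :=
    measurable_cleanCount.comp measurable_snd
  have hs : ∀ v : Fin n → ℝ,
      Measurable fun q : (Fin n × Fin p → ℝ) × (Fin p → ℝ) => cleanSum q.1 q.2 v := fun v =>
    Finset.measurable_fun_sum _ fun j _ => Measurable.ite (hz j) (by fun_prop) measurable_const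
  have hg : ∀ v : Fin n → ℝ,
      Measurable fun q : (Fin n × Fin p → ℝ) × (Fin p → ℝ) => signedSum q.1 q.2 v := fun v => by
    unfold signedSum; fun_prop
  simp only [deviation, Set.mem_iUnion, Set.mem_union, Set.mem_ofPred_eq]
  simp only [Set.ofPred_exists, Set.ofPred_or]
  refine Finset.measurableSet_biUnion N fun v _ => ?_
  exact ((measurableSet_le (hs v) (hc.div_const _)).union
    (measurableSet_le (hc.const_mul _) (hs v))).union
    ((measurableSet_le measurable_const ((hg v).const_mul _)).union
    (measurableSet_le measurable_const ((hg v).const_mul _)))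

theorem signedSum_lt_cleanSum {n p : ℕ} {N : Finset (EuclideanSpace ℝ (Fin n))}
    (hnet : ∀ v : EuclideanSpace ℝ (Fin n), ‖v‖ = 1 → ∃ c ∈ N, ‖v - c‖ ≤ 1 / 192)
    {a : ℝ} (ha : 0 ≤ a) {z : Fin p → ℝ} {x : Fin n × Fin p → ℝ} (hx : x ∉ deviation N a z)
    (haz : 2 * a < cleanCount z / 32) {v : Fin n → ℝ} (hv : v ≠ 0) :
    signedSum x z v < cleanSum x z v := by
  simp only [deviation, Set.mem_iUnion, Set.mem_union, Set.mem_ofPred_eq, not_exists, not_or,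
    not_le] at hx
  -- With values in ℓ¹, the clean sum becomes the norm of a linear map.
  let T : EuclideanSpace ℝ (Fin n) →L[ℝ] PiLp 1 (fun _ : Fin p => ℝ) := LinearMap.toContinuousLinearMap
    { toFun := fun v => WithLp.toLp 1 fun j => if z j = 0 then ∑ i, x (i, j) * v i else 0
      map_add' := fun u w => by
        ext j; simp only [PiLp.add_apply, mul_add, Finset.sum_add_distrib]; split_ifs <;> simp
      map_smul' := fun c w => by
        ext j; simp only [PiLp.smul_apply, smul_eq_mul, RingHom.id_apply]
        split_ifs
        · rw [Finset.mul_sum]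
          exact Finset.sum_congr rfl fun i _ => by ring
        · simp }
  let G : EuclideanSpace ℝ (Fin n) →L[ℝ] ℝ := LinearMap.toContinuousLinearMap
    { toFun := fun v => signedSum x z v
      map_add' := fun u w => by
        simp only [signedSum, PiLp.add_apply, mul_add, Finset.sum_add_distrib]
      map_smul' := fun c w => by
        simp only [signedSum, PiLp.smul_apply, smul_eq_mul, RingHom.id_apply, Finset.mul_sum]
        exact Finset.sum_congr rfl fun j _ => Finset.sum_congr rfl fun i _ => by ring }
  have hT : ∀ w, ‖T w‖ = cleanSum x z w := fun w => by
    rw [PiLp.norm_eq_of_L1]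
    refine Finset.sum_congr rfl fun j _ => ?_
    change ‖if z j = 0 then ∑ i, x (i, j) * w i else 0‖ = _
    split_ifs <;> simp
  have hG : ∀ w, G w = signedSum x z w := fun w => rfl
  have hT1 : ‖T‖ ≤ 2 * (3 * cleanCount z) :=
    opNorm_le_of_net (by norm_num) hnet T (by positivity) fun c hc => by
      rw [hT]; exact (hx c hc).1.2.le
  have hG1 : ‖G‖ ≤ 2 * a := opNorm_le_of_net (by norm_num) hnet G ha fun c hc => by
    rw [hG, Real.norm_eq_abs, abs_le]
    have := (hx c hc).2
    constructor <;> linarith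
  -- With `m` clean coordinates, `‖T‖ ≤ 6m`, so the mesh `1/192` costs `m/32` of the lower bound
  -- `m/16`; the remaining `m/32` exceeds `2a`.
  have hunit : ∀ u : EuclideanSpace ℝ (Fin n), ‖u‖ = 1 → G u < ‖T u‖ := fun u hu => by
    have h1 := le_norm_apply_of_net hnet T (B := cleanCount z / 16)
      (fun c hc => by rw [hT]; exact (hx c hc).1.1.le) hu
    have h2 := (le_abs_self (G u)).trans (G.le_of_opNorm_le hG1 u)
    rw [hu] at h2
    linarith
  let w : EuclideanSpace ℝ (Fin n) := WithLp.toLp 2 v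
  have hw : 0 < ‖w‖ := norm_pos_iff.2 fun h => hv (by simpa [w] using congrArg WithLp.ofLp h)
  have h1 := hunit (‖w‖⁻¹ • w) (by rw [norm_smul, norm_inv, norm_norm, inv_mul_cancel₀ hw.ne'])
  rw [map_smul, map_smul, norm_smul, norm_inv, norm_norm, smul_eq_mul, hT, hG] at h1
  exact lt_of_mul_lt_mul_left h1 (inv_pos.2 hw).le

/-! ### The number of clean coordinates. -/

section Contamination

variable {ε : ℝ} (h0 : 0 ≤ ε) (h1 : ε < 1)

include h0 h1

theorem isProbabilityMeasure_contaminatedLaw (Q : Measure ℝ) [IsProbabilityMeasure Q] :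
    IsProbabilityMeasure (contaminatedLaw ε Q) := by
  constructor
  simp only [contaminatedLaw, Measure.add_apply, Measure.smul_apply, measure_univ, smul_eq_mul,
    mul_one]
  rw [← ENNReal.ofReal_add (by linarith) h0]; simp

/-- The count dominates a binomial variable with parameters `p` and `1 - ε`; atoms of `Q j` at 0
only help. The rate is `3/5 - 1/2 = 1/10`. -/
theorem cleanCount_lower_tail {p : ℕ} (Q : Fin p → Measure ℝ) [∀ j, IsProbabilityMeasure (Q j)] :
    (Measure.pi fun j => contaminatedLaw ε (Q j)) {z | cleanCount z < p * (1 - ε) / 2} ≤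
      ENNReal.ofReal (Real.exp (-(p * (1 - ε) / 10))) := by
  have := fun j => isProbabilityMeasure_contaminatedLaw h0 h1 (Q j)
  have hexp : Real.exp (-1) ≤ 2 / 5 := by
    rw [Real.exp_neg, inv_le_comm₀ (Real.exp_pos _) (by norm_num)]
    exact le_trans (by norm_num) Real.exp_one_gt_d9.le
  have hmeas : Measurable fun y : ℝ => if y = 0 then (-1 : ℝ) else 0 :=
    Measurable.ite (measurableSet_singleton 0) measurable_const measurable_const
  refine (measure_mono fun z hz => ?_).trans ((pi_chernoff
    (P := fun j => contaminatedLaw ε (Q j)) (f := fun j y => if y = 0 then -1 else 0)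
    (B := fun j => Real.exp (-(3 / 5 * (1 - ε)))) (fun j => hmeas) (fun j => (Real.exp_pos _).le)
    (fun j => ?_) (-(p * (1 - ε) / 2))).trans (ENNReal.ofReal_le_ofReal ?_))
  · have hz : (cleanCount z : ℝ) < p * (1 - ε) / 2 := hz
    have e : ∑ j, (if z j = 0 then (-1 : ℝ) else 0) = -cleanCount z := by
      simp [← Finset.sum_filter, cleanCount]
    simp only [Set.mem_ofPred_eq, e]
    linarith
  · rw [contaminatedLaw, lintegral_add_measure, lintegral_smul_measure, lintegral_smul_measure,
      lintegral_dirac, smul_eq_mul, smul_eq_mul]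
    have hQ : ∫⁻ y, ENNReal.ofReal (Real.exp (if y = 0 then -1 else 0)) ∂Q j ≤ 1 := by
      calc _ ≤ ∫⁻ _, 1 ∂Q j := lintegral_mono fun y => by
            rw [← ENNReal.ofReal_one]
            refine ENNReal.ofReal_le_ofReal (Real.exp_le_one_iff.2 ?_)
            split_ifs <;> norm_num
        _ = 1 := by simp
    calc _ ≤ ENNReal.ofReal (1 - ε) * ENNReal.ofReal (2 / 5) + ENNReal.ofReal ε * 1 := by
          gcongr
          simpa using hexp
      _ = ENNReal.ofReal ((1 - ε) * (2 / 5) + ε) := by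
          rw [mul_one, ← ENNReal.ofReal_mul (by linarith), ← ENNReal.ofReal_add (by nlinarith) h0]
      _ ≤ _ := ENNReal.ofReal_le_ofReal (by
          have := Real.add_one_le_exp (-(3 / 5 * (1 - ε)))
          linarith)
  · rw [Finset.prod_const, ← Real.exp_nat_mul, ← Real.exp_add]
    refine Real.exp_le_exp.2 (le_of_eq ?_)
    simp only [Finset.card_univ, Fintype.card_fin]
    ring

end Contamination

end ModelRepair

/-! ### Choice of constants and the failure event. -/

namespace ModelRepair

open scoped ENNReal NNReal

theorem exp_neg_le_inv_of_le {x y : ℝ} (hx : 0 < x) (hxy : x ≤ y) : Real.exp (-y) ≤ 1 / x := by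
  rw [Real.exp_neg, one_div]
  exact inv_anti₀ hx (by linarith [Real.add_one_le_exp y])

theorem log_exp_one_mul_div {n p : ℕ} (hn : 1 ≤ n) (hnp : n ≤ p) :
    Real.log (Real.exp 1 * p / n) = 1 + Real.log (p / n) := by
  have hn' : (n : ℝ) ≠ 0 := by positivity
  have hp' : (p : ℝ) ≠ 0 := by
    have : 0 < p := by omega
    positivity
  rw [mul_div_assoc, Real.log_mul (Real.exp_pos 1).ne' (div_ne_zero hp' hn'), Real.log_exp]

theorem one_le_log_exp_one_mul_div {n p : ℕ} (hn : 1 ≤ n) (hnp : n ≤ p) :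
    1 ≤ Real.log (Real.exp 1 * p / n) := by
  rw [log_exp_one_mul_div hn hnp]
  have hn' : (0 : ℝ) < n := by positivity
  have := Real.log_nonneg ((one_le_div hn').2 (by exact_mod_cast hnp : (n : ℝ) ≤ p))
  linarith

theorem log_le_mul_log_exp_one_mul_div {n p : ℕ} (hn : 1 ≤ n) (hnp : n ≤ p) :
    Real.log p ≤ n * Real.log (Real.exp 1 * p / n) := by
  rw [log_exp_one_mul_div hn hnp]
  have hn1 : (1 : ℝ) ≤ n := by exact_mod_cast hn
  have hn' : (0 : ℝ) < n := by linarith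
  have hp' : (0 : ℝ) < p := lt_of_lt_of_le hn' (by exact_mod_cast hnp)
  have h1 := Real.log_nonneg ((one_le_div hn').2 (by exact_mod_cast hnp : (n : ℝ) ≤ p))
  have h2 := Real.log_le_sub_one_of_pos hn'
  have h3 : Real.log p = Real.log (p / n) + Real.log n := by
    rw [Real.log_div hp'.ne' hn'.ne']; ring
  nlinarith

theorem sqrt_mul_log_le {n p : ℕ} {ε : ℝ} (hn : 1 ≤ n) (hnp : n ≤ p) (h1 : ε < 1)
    (hc : √((n : ℝ) / p) * Real.log (Real.exp 1 * p / n) / (1 - ε) ≤ 1 / 1024) :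
    1024 * (√(n * p) * Real.log (Real.exp 1 * p / n)) ≤ p * (1 - ε) := by
  have hp' : (0 : ℝ) < p := by exact_mod_cast (by omega : 0 < p)
  have hε : 0 < 1 - ε := by linarith
  have e : √((n : ℝ) * p) = p * √((n : ℝ) / p) := by
    rw [← Real.sqrt_sq hp'.le, ← Real.sqrt_mul (by positivity), Real.sqrt_sq hp'.le]
    congr 1; field_simp
  rw [div_le_iff₀ hε] at hc
  rw [e]
  nlinarith

/-- The deviation event is unlikely when there are many clean coordinates. -/
theorem card_mul_tails_le {n p : ℕ} (hn : 1 ≤ n) (hnp : n ≤ p) {m l : ℝ}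
    (hl : l = Real.log (Real.exp 1 * p / n)) (hm : 512 * (√(n * p) * l) ≤ m) {K : ℝ}
    (hK : K ≤ 385 ^ n) :
    K * (2 * Real.exp (-(3 / 2) * m) + 2 * Real.exp (-((4 * (√(n * p) * l)) ^ 2 / (2 * p)))) ≤
      4 / √p := by
  have hn1 : (1 : ℝ) ≤ n := by exact_mod_cast hn
  have hnp' : (n : ℝ) ≤ p := by exact_mod_cast hnp
  have hp' : (0 : ℝ) < p := by linarith
  have hl1 : 1 ≤ l := hl ▸ one_le_log_exp_one_mul_div hn hnp
  have hlog : Real.log p ≤ n * l := hl ▸ log_le_mul_log_exp_one_mul_div hn hnp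
  have hRn : (n : ℝ) ≤ √(n * p) := Real.le_sqrt_of_sq_le (by nlinarith)
  have hRp : √(p : ℝ) ≤ √(n * p) := Real.sqrt_le_sqrt (by nlinarith)
  have hRl : √(n * p : ℝ) ≤ √(n * p) * l := le_mul_of_one_le_right (Real.sqrt_nonneg _) hl1
  have hsp : 0 < √(p : ℝ) := Real.sqrt_pos.2 hp'
  have hK' : K ≤ Real.exp (6 * n) := by
    refine hK.trans ?_
    rw [mul_comm, Real.exp_nat_mul]
    refine pow_le_pow_left₀ (by norm_num) ?_ _
    calc (385 : ℝ) ≤ 2.718 ^ 6 := by norm_num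
      _ ≤ Real.exp 1 ^ 6 := pow_le_pow_left₀ (by norm_num)
        (le_trans (by norm_num) Real.exp_one_gt_d9.le) _
      _ = Real.exp 6 := by rw [← Real.exp_nat_mul]; norm_num
  -- The factor 4 yields the exponent `8 n l²`, which pays for the net's `6n` and for `(log p) / 2`.
  have e : (4 * (√(n * p : ℝ) * l)) ^ 2 / (2 * p) = 8 * n * l ^ 2 := by
    rw [mul_pow, mul_pow, Real.sq_sqrt (by positivity)]; field_simp; ring
  have t1 : Real.exp (6 * n) * Real.exp (-(3 / 2) * m) ≤ 1 / √p := by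
    rw [← Real.exp_add, show 6 * (n : ℝ) + -(3 / 2) * m = -(3 / 2 * m - 6 * n) by ring]
    exact exp_neg_le_inv_of_le hsp (by linarith)
  have t2 : Real.exp (6 * n) * Real.exp (-(8 * n * l ^ 2)) ≤ 1 / √p := by
    rw [← Real.exp_add]
    calc _ ≤ Real.exp (-(1 / 2 * Real.log p)) := by
          refine Real.exp_le_exp.2 ?_
          have hnl : (n : ℝ) ≤ n * l := le_mul_of_one_le_right (by linarith) hl1
          have : (n : ℝ) * l ≤ n * l * l := le_mul_of_one_le_right (by linarith) hl1
          nlinarith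
      _ = 1 / √p := by
          rw [Real.exp_neg, one_div (√(p : ℝ)), Real.sqrt_eq_rpow, Real.rpow_def_of_pos hp', mul_comm]
  rw [e]
  calc _ ≤ Real.exp (6 * n) * (2 * Real.exp (-(3 / 2) * m) + 2 * Real.exp (-(8 * n * l ^ 2))) := by
        gcongr
    _ ≤ 2 * (1 / √p) + 2 * (1 / √p) := by linarith
    _ = 4 / √p := by ring

/-- Off an event of probability at most `5 / √p`, the null-space type condition for exact recovery
holds. -/
theorem exists_failure_set {n p : ℕ} {ε : ℝ} (hn : 1 ≤ n) (hnp : n ≤ p) (h0 : 0 ≤ ε) (h1 : ε < 1)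
    (hc : √((n : ℝ) / p) * Real.log (Real.exp 1 * p / n) / (1 - ε) ≤ 1 / 1024)
    (Q : Fin p → Measure ℝ) [∀ j, IsProbabilityMeasure (Q j)] :
    ∃ S : Set ((Fin n × Fin p → ℝ) × (Fin p → ℝ)),
      ((Measure.pi fun _ : Fin n × Fin p => gaussianReal 0 1).prod
        (Measure.pi fun j => contaminatedLaw ε (Q j))) S ≤ ENNReal.ofReal (5 / √p) ∧
      ∀ q ∉ S, ∀ v : Fin n → ℝ, v ≠ 0 → signedSum q.1 q.2 v < cleanSum q.1 q.2 v := by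
  have := fun j => isProbabilityMeasure_contaminatedLaw h0 h1 (Q j)
  have hM := sqrt_mul_log_le hn hnp h1 hc
  have hp : 0 < p := by omega
  have hp1 : (1 : ℝ) ≤ p := by exact_mod_cast hp
  have hn1 : (1 : ℝ) ≤ n := by exact_mod_cast hn
  have hsp : 0 < √(p : ℝ) := Real.sqrt_pos.2 (by linarith)
  obtain ⟨l, hl⟩ : ∃ l, l = Real.log (Real.exp 1 * p / n) := ⟨_, rfl⟩
  have hl1 : 1 ≤ l := hl ▸ one_le_log_exp_one_mul_div hn hnp
  rw [← hl] at hM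
  have hRl : √(p : ℝ) ≤ √(n * p) * l :=
    (Real.sqrt_le_sqrt (by nlinarith)).trans (le_mul_of_one_le_right (Real.sqrt_nonneg _) hl1)
  obtain ⟨N, hN1, hNcard, hnet⟩ := exists_sphere_net (EuclideanSpace ℝ (Fin n))
    (η := 1 / 192) (by norm_num)
  rw [finrank_euclideanSpace_fin, show (1 + 2 / (1 / 192) : ℝ) = 385 by norm_num] at hNcard
  let a := 4 * (√(n * p : ℝ) * l)
  have ha : 0 ≤ a := by positivity
  let S₁ : Set (Fin p → ℝ) := {z | cleanCount z < p * (1 - ε) / 2}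
  -- Slices over a `z` with too few clean coordinates are empty, so the deviation estimate is needed
  -- only for the other `z`.
  let S₂ : Set ((Fin n × Fin p → ℝ) × (Fin p → ℝ)) :=
    {q | p * (1 - ε) / 2 ≤ cleanCount q.2 ∧ q.1 ∈ deviation N a q.2}
  have hmeas : MeasurableSet S₂ := by
    refine MeasurableSet.inter ?_ (measurableSet_deviation N a)
    exact measurableSet_le measurable_const (measurable_cleanCount.comp measurable_snd)
  refine ⟨Set.univ ×ˢ S₁ ∪ S₂, ?_, ?_⟩
  · have b1 : ((Measure.pi fun _ : Fin n × Fin p => gaussianReal 0 1).prod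
        (Measure.pi fun j => contaminatedLaw ε (Q j))) (Set.univ ×ˢ S₁) ≤
        ENNReal.ofReal (1 / √p) := by
      rw [Measure.prod_prod, measure_univ, one_mul]
      exact (cleanCount_lower_tail h0 h1 Q).trans
        (ENNReal.ofReal_le_ofReal (exp_neg_le_inv_of_le hsp (by linarith)))
    have b2 : ((Measure.pi fun _ : Fin n × Fin p => gaussianReal 0 1).prod
        (Measure.pi fun j => contaminatedLaw ε (Q j))) S₂ ≤ ENNReal.ofReal (4 / √p) := by
      rw [Measure.prod_apply_symm hmeas]
      calc _ ≤ ∫⁻ _, ENNReal.ofReal (4 / √p) ∂Measure.pi fun j => contaminatedLaw ε (Q j) := by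
            refine lintegral_mono fun z => ?_
            by_cases hz : p * (1 - ε) / 2 ≤ cleanCount z
            · refine (measure_mono fun x hx => hx.2).trans
                ((measure_deviation_le hN1 hp ha z).trans (ENNReal.ofReal_le_ofReal ?_))
              exact card_mul_tails_le hn hnp hl (by linarith) hNcard
            · refine (measure_mono (t := ∅) fun x hx => hz hx.1).trans ?_
              simp
        _ = _ := by simp
    refine (measure_union_le _ _).trans ((add_le_add b1 b2).trans (le_of_eq ?_))
    rw [← ENNReal.ofReal_add (by positivity) (by positivity)]
    congr 1; ring
  · rintro ⟨x, z⟩ hq v hv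
    simp only [S₁, S₂, Set.mem_union, Set.mem_prod, Set.mem_univ, true_and, Set.mem_ofPred_eq,
      not_or, not_and, not_lt] at hq
    refine signedSum_lt_cleanSum hnet ha (hq.2 hq.1) ?_ hv
    have := hq.1
    simp only [a]
    linarith

end ModelRepair

theorem mainTheorem4 :
    -- minimum-norm solutions and gradient descent started at `0` lie in the row space
    (∀ (n p : ℕ) (X : Matrix (Fin n) (Fin p) ℝ) (y : Fin n → ℝ) (θ : Fin p → ℝ),
        ModelRepair.IsMinNormSolution X y θ → θ ∈ ModelRepair.rowSpace X) ∧
    (∀ (n p : ℕ) (L : ℝ → ℝ → ℝ) (γ : ℕ → ℝ) (X : Matrix (Fin n) (Fin p) ℝ) (y : Fin n → ℝ)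
        (t : ℕ), ModelRepair.gradientDescent L γ X y t ∈ ModelRepair.rowSpace X) ∧
    -- exact repair with high probability, for every model in the row space
    ∃ c : ℝ, 0 < c ∧ ∀ δ : ℝ, 0 < δ → ∃ p₀ : ℕ,
      ∀ (n p : ℕ) (ε : ℝ), 1 ≤ n → n ≤ p → p₀ ≤ p → 0 ≤ ε → ε < 1 →
        √((n : ℝ) / (p : ℝ)) * Real.log (Real.exp 1 * (p : ℝ) / (n : ℝ)) / (1 - ε) ≤ c →
        ∀ (Q : Fin p → Measure ℝ), (∀ j, IsProbabilityMeasure (Q j)) →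
        ∀ (Ω : Type*) [MeasurableSpace Ω] (μ : Measure Ω) [IsProbabilityMeasure μ]
          (X : Ω → Matrix (Fin n) (Fin p) ℝ) (z : Ω → Fin p → ℝ) (θ : Ω → Fin p → ℝ),
          -- the entries of the design are i.i.d. standard normal
          (∀ i j, HasLaw (fun ω => X ω i j) (gaussianReal 0 1) μ) →
          iIndepFun (fun (ij : Fin n × Fin p) ω => X ω ij.1 ij.2) μ →
          -- the coordinates of the noise are independent, the `j`-th from `(1 - ε) δ₀ + ε Q j`
          (∀ j, HasLaw (fun ω => z ω j) (ModelRepair.contaminatedLaw ε (Q j)) μ) →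
          iIndepFun (fun j ω => z ω j) μ →
          -- the noise is independent of the design
          IndepFun (fun ω (ij : Fin n × Fin p) => X ω ij.1 ij.2) z μ →
          -- the model lies in the row space of the design
          (∀ᵐ ω ∂μ, θ ω ∈ ModelRepair.rowSpace (X ω)) →
          μ {ω | ModelRepair.repairedModels (X ω) (θ ω + z ω) ≠ {θ ω}} ≤ ENNReal.ofReal δ := by
  refine ⟨fun n p X y θ h => h.mem_rowSpace, fun n p L γ X y t =>
    ModelRepair.gradientDescent_mem_rowSpace L γ X y t, 1 / 1024, by norm_num, fun δ hδ =>
    ⟨⌈(5 / δ) ^ 2⌉₊, ?_⟩⟩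
  intro n p ε hn hnp hp h0 h1 hc Q hQ Ω _ μ _ X z θ hX hXi hz hzi hXz hθ
  have := fun j => ModelRepair.isProbabilityMeasure_contaminatedLaw h0 h1 (Q j)
  obtain ⟨S, hS, hgood⟩ := ModelRepair.exists_failure_set hn hnp h0 h1 hc Q
  have hlaw : HasLaw (fun ω => (fun ij : Fin n × Fin p => X ω ij.1 ij.2, z ω)) _ μ :=
    IndepFun.hasLaw_prod (iIndepFun.hasLaw_pi (fun ij => hX ij.1 ij.2) hXi)
      (iIndepFun.hasLaw_pi hz hzi) hXz
  have hsub : {ω | ModelRepair.repairedModels (X ω) (θ ω + z ω) ≠ {θ ω}} ⊆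
      {ω | ¬ θ ω ∈ ModelRepair.rowSpace (X ω)} ∪
        (fun ω => (fun ij : Fin n × Fin p => X ω ij.1 ij.2, z ω)) ⁻¹' S := by
    intro ω hω
    by_contra hne
    rw [Set.mem_union, not_or] at hne
    refine hω (ModelRepair.repairedModels_eq_singleton (not_not.1 hne.1) fun v hv => ?_)
    exact hgood _ hne.2 v hv
  have hδp : 5 / √(p : ℝ) ≤ δ := by
    have hp' : (5 / δ) ^ 2 ≤ p := (Nat.le_ceil _).trans (by exact_mod_cast hp)
    have := Real.le_sqrt_of_sq_le hp'
    have h5 : 0 < 5 / δ := by positivity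
    rw [div_le_comm₀ (h5.trans_le this) hδ] at *
    exact this
  calc _ ≤ μ {ω | ¬ θ ω ∈ ModelRepair.rowSpace (X ω)} +
        μ ((fun ω => (fun ij : Fin n × Fin p => X ω ij.1 ij.2, z ω)) ⁻¹' S) :=
        (measure_mono hsub).trans (measure_union_le _ _)
    _ ≤ 0 + ENNReal.ofReal (5 / √p) := by
        refine add_le_add (le_of_eq hθ) ?_
        -- `S` need not be measurable: this inequality holds for outer measure.
        refine (Measure.le_map_apply hlaw.aemeasurable S).trans ?_
        rw [hlaw.map_eq]; exact hS
    _ ≤ ENNReal.ofReal δ := by rw [zero_add]; exact ENNReal.ofReal_le_ofReal hδp
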